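/- Let $du$ be the normalised (total mass one) Haar measure on $\mathrm{SU}(2)$. For $l\in\frac12\mathbb N_0$ let $t^l$ denote the irreducible unitary representation of $\mathrm{SU}(2)$ of dimension $2l+1$: it acts on the homogeneous polynomials of degree $2l$ in two variables by $(t^l(u)P)(x,y)=P((x,y)u)$, and is written as a matrix in the orthonormal basis $\binom{2l}{i}^{1/2}x^iy^{2l-i}$, $0\le i\le 2l$. For $f\in L^1(\mathrm{SU}(2))$ put $$\widehat f(l)=\int_{\mathrm{SU}(2)}f(u)\,t^l(u)^*\,du\in\mathbb C^{(2l+1)\times(2l+1)}.$$ Let $1<p\le 2$. Then there is a constant $C_p$, depending only on $p$, such that for every $f\in L^p(\mathrm{SU}(2))$ $$\sum_{\xi\in\frac12\mathbb N_0}(2\xi+1)^{\frac{5p}{2}-4}\left(\sup_{\substack{k\in\frac12\mathbb N_0\\ 2k+1\ge 2\xi+1}}\frac1{(2k+1)^3}\left|\sum_{\substack{l\in\frac12\mathbb N_0\\ 2l+1\le 2k+1}}(2l+1)\operatorname{Tr}\widehat f(l)\right|\right)^p\le C_p\,\|f\|^p_{L^p(\mathrm{SU}(2))}.$$ -/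

import Mathlib

/-- The compact group `SU(2)` of unitary complex `2 × 2` matrices of determinant one, with the
topology it inherits from the space of matrices. -/
abbrev SU2 : Type := Matrix.specialUnitaryGroup (Fin 2) ℂ

namespace SU2

instance : IsTopologicalGroup SU2 where
  continuous_inv :=
    (continuous_star.comp continuous_subtype_val).subtype_mk fun g => (star g).2

instance : CompactSpace SU2 := by
  have hclosed : IsClosed {A : Matrix (Fin 2) (Fin 2) ℂ | A * star A = 1 ∧ A.det = 1} := by
    apply IsClosed.inter
    · exact isClosed_eq (by fun_prop) continuous_const
    · exact isClosed_eq (by fun_prop) continuous_const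
  have hball : IsCompact {A : Matrix (Fin 2) (Fin 2) ℂ |
      ∀ i, A i ∈ {v : Fin 2 → ℂ | ∀ j, v j ∈ Metric.closedBall (0 : ℂ) 1}} :=
    isCompact_pi_infinite fun _ => isCompact_pi_infinite fun _ => isCompact_closedBall 0 1
  refine isCompact_iff_compactSpace.mp (hball.of_isClosed_subset ?_ ?_)
  · convert hclosed using 1
    ext A
    simp only [SetLike.mem_coe, Matrix.mem_specialUnitaryGroup_iff, Matrix.mem_unitaryGroup_iff]
    rfl
  · intro A hA i j
    rw [mem_closedBall_zero_iff]
    exact entry_norm_bound_of_unitary (Matrix.mem_specialUnitaryGroup_iff.mp hA).1 i j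

noncomputable instance : MeasurableSpace SU2 := borel SU2

instance : BorelSpace SU2 := ⟨rfl⟩

/-- The normalised Haar measure `du` on `SU(2)`: the Haar measure of total mass one. -/
noncomputable def haar : MeasureTheory.Measure SU2 := MeasureTheory.Measure.haarMeasure ⊤

end SU2

/-- The polynomial `(a X + c) ^ j * (b X + d) ^ (n - j)` attached to `g = !![a, b; c, d]`: the
dehomogenisation (`x = X`, `y = 1`) of the image of the monomial `x ^ j * y ^ (n - j)` under
the substitution `(x, y) ↦ (x, y) * g`. -/
noncomputable def binaryForm (n : ℕ) (g : Matrix (Fin 2) (Fin 2) ℂ) (j : ℕ) : Polynomial ℂ :=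
  (Polynomial.C (g 0 0) * Polynomial.X + Polynomial.C (g 1 0)) ^ j *
    (Polynomial.C (g 0 1) * Polynomial.X + Polynomial.C (g 1 1)) ^ (n - j)

/-- The matrix of the operator `(π(g) P)(x, y) = P((x, y) * g)` on the space of homogeneous
polynomials of degree `n` in two variables, in the basis
`√(n choose i) * x ^ i * y ^ (n - i)`, `0 ≤ i ≤ n`. -/
noncomputable def binaryFormMatrix (n : ℕ) (g : Matrix (Fin 2) (Fin 2) ℂ) :
    Matrix (Fin (n + 1)) (Fin (n + 1)) ℂ :=
  Matrix.of fun i j =>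
    ((√(n.choose j : ℝ) / √(n.choose i : ℝ) : ℝ) : ℂ) * (binaryForm n g j).coeff i

theorem binaryForm_natDegree_le (n : ℕ) (g : Matrix (Fin 2) (Fin 2) ℂ) (j : ℕ) (hj : j ≤ n) :
    (binaryForm n g j).natDegree ≤ n := by
  have h := fun a b : ℂ => Polynomial.natDegree_linear_le (a := a) (b := b)
  refine Polynomial.natDegree_mul_le.trans ?_
  have h1 := Polynomial.natDegree_pow_le_of_le j (h (g 0 0) (g 1 0))
  have h2 := Polynomial.natDegree_pow_le_of_le (n - j) (h (g 0 1) (g 1 1))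
  omega

theorem sum_coeff_binaryForm {A : Type*} [CommRing A] [Algebra ℂ A] (n : ℕ)
    (g : Matrix (Fin 2) (Fin 2) ℂ) (j : ℕ) (hj : j ≤ n) (x y : A) :
    ∑ i ∈ Finset.range (n + 1), (binaryForm n g j).coeff i • (x ^ i * y ^ (n - i)) =
      (g 0 0 • x + g 1 0 • y) ^ j * (g 0 1 • x + g 1 1 • y) ^ (n - j) := by
  have hpow : ∀ (a c : ℂ) (m : ℕ),
      ((Polynomial.C a * Polynomial.X + Polynomial.C c) ^ m).homogenize m =
        (MvPolynomial.C a * MvPolynomial.X 0 + MvPolynomial.C c * MvPolynomial.X 1) ^ m := by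
    intro a c m
    induction m with
    | zero => simp
    | succ m ih =>
      rw [pow_succ, Polynomial.homogenize_mul _ _ (m := m) (n := 1), ih, pow_succ]
      · simp
      · simpa using Polynomial.natDegree_pow_le_of_le m
          (Polynomial.natDegree_linear_le (a := a) (b := c))
      · exact Polynomial.natDegree_linear_le
  have hp : (binaryForm n g j).homogenize n =
      (MvPolynomial.C (g 0 0) * MvPolynomial.X 0 + MvPolynomial.C (g 1 0) * MvPolynomial.X 1) ^ j *
      (MvPolynomial.C (g 0 1) * MvPolynomial.X 0 +
        MvPolynomial.C (g 1 1) * MvPolynomial.X 1) ^ (n - j) := by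
    have h := fun a b : ℂ => Polynomial.natDegree_linear_le (a := a) (b := b)
    have h1 := Polynomial.natDegree_pow_le_of_le j (h (g 0 0) (g 1 0))
    have h2 := Polynomial.natDegree_pow_le_of_le (n - j) (h (g 0 1) (g 1 1))
    rw [mul_one] at h1 h2
    have := Polynomial.homogenize_mul _ _ h1 h2
    rw [hpow, hpow, Nat.add_sub_cancel' hj] at this
    exact this
  have hs : ∑ i ∈ Finset.range (n + 1), (binaryForm n g j).coeff i • (x ^ i * y ^ (n - i)) =
      MvPolynomial.aeval ![x, y] ((binaryForm n g j).homogenize n) := by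
    conv_rhs => rw [Polynomial.as_sum_range' _ (n + 1)
      (Nat.lt_succ_of_le (binaryForm_natDegree_le n g j hj))]
    rw [Polynomial.homogenize_finsetSum, map_sum]
    refine Finset.sum_congr rfl fun i hi => ?_
    rw [Polynomial.homogenize_monomial (Nat.le_of_lt_succ (Finset.mem_range.mp hi)),
      MvPolynomial.aeval_monomial, Algebra.smul_def]
    congr 1
    simp
  rw [hs, hp]
  simp [Algebra.smul_def]

theorem binaryFormMatrix_mul (n : ℕ) (g h : Matrix (Fin 2) (Fin 2) ℂ) :
    binaryFormMatrix n (g * h) = binaryFormMatrix n g * binaryFormMatrix n h := by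
  have key : ∀ j ≤ n, binaryForm n (g * h) j =
      ∑ k ∈ Finset.range (n + 1), (binaryForm n h j).coeff k • binaryForm n g k := by
    intro j hj
    have := sum_coeff_binaryForm n h j hj
      (Polynomial.C (g 0 0) * Polynomial.X + Polynomial.C (g 1 0))
      (Polynomial.C (g 0 1) * Polynomial.X + Polynomial.C (g 1 1))
    simp only [binaryForm] at this ⊢
    rw [this]
    simp only [Matrix.mul_apply, Fin.sum_univ_two, Polynomial.smul_eq_C_mul, map_add, map_mul]
    ring
  have hc : ∀ i : Fin (n + 1), ((√(n.choose i : ℝ) : ℝ) : ℂ) ≠ 0 := by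
    intro i
    have := Nat.choose_pos (Nat.le_of_lt_succ i.2)
    exact_mod_cast (Real.sqrt_pos.mpr (by exact_mod_cast this)).ne'
  ext i j
  simp only [binaryFormMatrix, Matrix.mul_apply, Matrix.of_apply]
  rw [key j (Nat.le_of_lt_succ j.2), Polynomial.finsetSum_coeff, Finset.sum_range,
    Finset.mul_sum]
  refine Finset.sum_congr rfl fun k _ => ?_
  have := hc k
  have := hc i
  push_cast
  rw [Polynomial.coeff_smul, smul_eq_mul]
  field_simp

theorem binaryFormMatrix_one (n : ℕ) : binaryFormMatrix n 1 = 1 := by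
  ext i j
  have hj : 0 < n.choose j := Nat.choose_pos (Nat.le_of_lt_succ j.2)
  have : √(n.choose j : ℝ) ≠ 0 := (Real.sqrt_pos.mpr (by exact_mod_cast hj)).ne'
  by_cases hij : i = j
  · subst hij
    simp [binaryFormMatrix, binaryForm, this]
  · have : (i : ℕ) ≠ j := fun h => hij (Fin.ext h)
    simp [binaryFormMatrix, binaryForm, Polynomial.coeff_X_pow, hij, this]

theorem choose_mul_coeff_binaryForm (n : ℕ) (g : Matrix (Fin 2) (Fin 2) ℂ) (i j : ℕ)
    (hi : i ≤ n) (hj : j ≤ n) :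
    (n.choose j : ℂ) * (binaryForm n g j).coeff i =
      (n.choose i : ℂ) * (binaryForm n g.transpose i).coeff j := by
  have hpow : ∀ (a c : ℂ), ((Polynomial.C a * Polynomial.X + Polynomial.C c) ^ n).coeff i =
      (n.choose i : ℂ) * (a ^ i * c ^ (n - i)) := by
    intro a c
    rw [add_pow, Polynomial.finsetSum_coeff, Finset.sum_eq_single i]
    · rw [mul_pow, ← Polynomial.C_pow, ← Polynomial.C_pow, ← Polynomial.C_eq_natCast,
        Polynomial.coeff_mul_C, Polynomial.coeff_mul_C, Polynomial.coeff_C_mul,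
        Polynomial.coeff_X_pow_self]
      ring
    · intro k _ hk
      rw [mul_pow, ← Polynomial.C_pow, ← Polynomial.C_pow, ← Polynomial.C_eq_natCast,
        Polynomial.coeff_mul_C, Polynomial.coeff_mul_C, Polynomial.coeff_C_mul,
        Polynomial.coeff_X_pow, if_neg hk.symm]
      ring
    · intro h
      exact absurd (Finset.mem_range.mpr (Nat.lt_succ_of_le hi)) h
  have hpoly : ∑ k ∈ Finset.range (n + 1),
      Polynomial.monomial k ((n.choose k : ℂ) * (binaryForm n g k).coeff i) =
        Polynomial.C (n.choose i : ℂ) * binaryForm n g.transpose i := by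
    refine Polynomial.funext fun y => ?_
    have h1 : ∑ k ∈ Finset.range (n + 1),
        Polynomial.C (y ^ k * (n.choose k : ℂ)) * binaryForm n g k =
        (Polynomial.C (g 0 0 * y + g 0 1) * Polynomial.X +
          Polynomial.C (g 1 0 * y + g 1 1)) ^ n := by
      have : Polynomial.C (g 0 0 * y + g 0 1) * Polynomial.X +
          Polynomial.C (g 1 0 * y + g 1 1) =
          Polynomial.C y * (Polynomial.C (g 0 0) * Polynomial.X + Polynomial.C (g 1 0)) +
          (Polynomial.C (g 0 1) * Polynomial.X + Polynomial.C (g 1 1)) := by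
        simp only [map_add, map_mul]
        ring
      rw [this, add_pow]
      refine Finset.sum_congr rfl fun k _ => ?_
      simp only [binaryForm, map_mul, map_pow, mul_pow, map_natCast]
      ring
    have h2 := congrArg (fun q : Polynomial ℂ => q.coeff i) h1
    simp only [Polynomial.finsetSum_coeff, Polynomial.coeff_C_mul, hpow] at h2
    simp only [Polynomial.eval_finsetSum, Polynomial.eval_monomial, Polynomial.eval_mul,
      Polynomial.eval_C, binaryForm, Polynomial.eval_pow, Polynomial.eval_add, Polynomial.eval_X,
      Matrix.transpose_apply] at h2 ⊢
    rw [← h2]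
    refine Finset.sum_congr rfl fun k _ => ?_
    ring
  have h := congrArg (fun q : Polynomial ℂ => q.coeff j) hpoly
  simpa [Polynomial.finsetSum_coeff, Polynomial.coeff_monomial, Nat.lt_succ_of_le hj] using h

theorem binaryFormMatrix_star (n : ℕ) (g : Matrix (Fin 2) (Fin 2) ℂ) :
    star (binaryFormMatrix n g) = binaryFormMatrix n (star g) := by
  have hstar : ∀ (i j : ℕ), star ((binaryForm n g i).coeff j) =
      (binaryForm n (star g).transpose i).coeff j := by
    intro i j
    have : binaryForm n (star g).transpose i = (binaryForm n g i).map (starRingEnd ℂ) := by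
      simp [binaryForm, Matrix.star_apply]
    rw [this, Polynomial.coeff_map]
    rfl
  ext i j
  have hi : 0 < n.choose i := Nat.choose_pos (Nat.le_of_lt_succ i.2)
  have hj : 0 < n.choose j := Nat.choose_pos (Nat.le_of_lt_succ j.2)
  have hsi : ((√(n.choose i : ℝ) : ℝ) : ℂ) ≠ 0 := by
    exact_mod_cast (Real.sqrt_pos.mpr (by exact_mod_cast hi)).ne'
  have hsj : ((√(n.choose j : ℝ) : ℝ) : ℂ) ≠ 0 := by
    exact_mod_cast (Real.sqrt_pos.mpr (by exact_mod_cast hj)).ne'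
  have hqi : (n.choose i : ℂ) = ((√(n.choose i : ℝ) : ℝ) : ℂ) ^ 2 := by
    rw [← Complex.ofReal_pow, Real.sq_sqrt (Nat.cast_nonneg _)]
    simp
  have hqj : (n.choose j : ℂ) = ((√(n.choose j : ℝ) : ℝ) : ℂ) ^ 2 := by
    rw [← Complex.ofReal_pow, Real.sq_sqrt (Nat.cast_nonneg _)]
    simp
  have key := choose_mul_coeff_binaryForm n (star g) i j (Nat.le_of_lt_succ i.2)
    (Nat.le_of_lt_succ j.2)
  rw [hqi, hqj] at key
  simp only [binaryFormMatrix, Matrix.star_apply, Matrix.of_apply, star_mul', hstar]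
  rw [RCLike.star_def, Complex.conj_ofReal]
  push_cast
  field_simp
  linear_combination -key

/-- The representation `t^l` of `SU(2)`, where `l = n / 2`: the irreducible unitary representation
of dimension `2 l + 1 = n + 1`, realised on the homogeneous polynomials of degree `n = 2 l` in two
variables, `(t^l(u) P)(x, y) = P((x, y) * u)`, and written as a matrix in the orthonormal basis
`√(n choose i) * x ^ i * y ^ (n - i)`. Every irreducible unitary representation of `SU(2)` is
equivalent to exactly one of these. -/
noncomputable def su2Rep (n : ℕ) : SU2 →* Matrix.unitaryGroup (Fin (n + 1)) ℂ where
  toFun u := ⟨binaryFormMatrix n u.1, by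
    rw [Matrix.mem_unitaryGroup_iff, binaryFormMatrix_star, ← binaryFormMatrix_mul,
      Matrix.mem_unitaryGroup_iff.mp (Matrix.mem_specialUnitaryGroup_iff.mp u.2).1,
      binaryFormMatrix_one]⟩
  map_one' := Subtype.ext (binaryFormMatrix_one n)
  map_mul' u v := Subtype.ext (binaryFormMatrix_mul n u.1 v.1)

/-- The Fourier coefficient `f̂(l) = ∫ f(u) t^l(u)^* du`, a matrix of size `2 l + 1`, where
`l = n / 2`; the integral is taken entry by entry. -/
noncomputable def su2Fourier (f : SU2 → ℂ) (n : ℕ) : Matrix (Fin (n + 1)) (Fin (n + 1)) ℂ :=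
  Matrix.of fun i j => ∫ u, f u * (star (su2Rep n u).1) i j ∂SU2.haar

/-! ### Continuity of the matrix coefficients -/

open MeasureTheory

/-! The partial sum over `l` is the pairing of `f` with the Dirichlet kernel `D_k = ∑ (l + 1) χ_l`,
indices being doubled spins (`sum_trace_su2Fourier`). Since `|χ_l| ≤ l + 1` and the `χ_l` are real
and orthonormal, both `‖D_k‖_∞` and `‖D_k‖_2 ^ 2` are at most `(k + 1) ^ 3`. With `q ≥ 2` conjugate
to `p`, this gives `‖D_k‖_q ≤ (k + 1) ^ (3 / p)`, and Hölder bounds the partial sum by `(k + 1) ^ (3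
/ p) ‖f‖_p`.

After division by `(k + 1) ^ 3` the exponent is negative, so the supremum over `k ≥ x` is controlled
by its value at `k = x`. Its `p`-th power times the weight is at most `(x + 1) ^ (-p / 2 - 1) ‖f‖_p
^ p`, which is summable: the termwise bound suffices, with no maximal inequality or interpolation of
operators.

Orthonormality (`integral_su2Char_mul`) comes from the vanishing of the Haar integrals of nontrivial
matrix coefficients and the recurrence `χ_1 χ_{n+1} = χ_{n+2} + χ_n`. -/

theorem continuous_coeff_mul {X : Type*} [TopologicalSpace X] {P Q : X → Polynomial ℂ}
    (hP : ∀ i, Continuous fun x => (P x).coeff i) (hQ : ∀ i, Continuous fun x => (Q x).coeff i)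
    (i : ℕ) : Continuous fun x => (P x * Q x).coeff i := by
  simp only [Polynomial.coeff_mul]
  exact continuous_finsetSum _ fun a _ => (hP _).mul (hQ _)

theorem continuous_coeff_pow {X : Type*} [TopologicalSpace X] {P : X → Polynomial ℂ}
    (hP : ∀ i, Continuous fun x => (P x).coeff i) (m i : ℕ) :
    Continuous fun x => (P x ^ m).coeff i := by
  induction m generalizing i with
  | zero => simpa using continuous_const
  | succ m ih =>
    simp only [pow_succ]
    exact continuous_coeff_mul ih hP i

theorem continuous_coeff_linear {X : Type*} [TopologicalSpace X] {a b : X → ℂ}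
    (ha : Continuous a) (hb : Continuous b) (i : ℕ) :
    Continuous fun x => (Polynomial.C (a x) * Polynomial.X + Polynomial.C (b x)).coeff i := by
  simp only [Polynomial.coeff_add, Polynomial.coeff_C_mul, Polynomial.coeff_C]
  refine (ha.mul continuous_const).add ?_
  split_ifs
  · exact hb
  · exact continuous_const

theorem continuous_su2Rep_apply (n : ℕ) (i j : Fin (n + 1)) :
    Continuous fun u : SU2 => (su2Rep n u).1 i j := by
  have hc (a b : Fin 2) : Continuous fun u : SU2 => u.1 a b :=
    (continuous_apply_apply a b).comp continuous_subtype_val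
  have h := continuous_coeff_mul
    (continuous_coeff_pow (continuous_coeff_linear (hc 0 0) (hc 1 0)) j)
    (continuous_coeff_pow (continuous_coeff_linear (hc 0 1) (hc 1 1)) (n - j)) i
  exact continuous_const.mul h

/-! ### Haar measure and characters -/

instance : IsProbabilityMeasure SU2.haar :=
  ⟨Measure.haarMeasure_self⟩

instance : SU2.haar.IsMulLeftInvariant :=
  inferInstanceAs (Measure.haarMeasure _).IsMulLeftInvariant

theorem SU2.integrable_of_continuous {g : SU2 → ℂ} (hg : Continuous g) :
    Integrable g SU2.haar :=
  hg.integrable_of_hasCompactSupport (HasCompactSupport.of_compactSpace g)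

/-- The character of the representation `su2Rep n`. -/
noncomputable def su2Char (n : ℕ) (u : SU2) : ℂ := (su2Rep n u).1.trace

theorem continuous_su2Char (n : ℕ) : Continuous (su2Char n) :=
  continuous_finsetSum Finset.univ fun i _ => continuous_su2Rep_apply n i i

theorem norm_su2Char_le (n : ℕ) (u : SU2) : ‖su2Char n u‖ ≤ n + 1 := by
  refine (norm_sum_le Finset.univ fun i => (su2Rep n u).1 i i).trans ?_
  refine (Finset.sum_le_sum fun i _ =>
    entry_norm_bound_of_unitary (su2Rep n u).2 i i).trans ?_
  simp

/-! ### The character recurrence -/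

theorem binaryFormMatrix_trace_of_triangular (n : ℕ) (g : Matrix (Fin 2) (Fin 2) ℂ)
    (hg : g 1 0 = 0) :
    (binaryFormMatrix n g).trace =
      ∑ j ∈ Finset.range (n + 1), g 0 0 ^ j * g 1 1 ^ (n - j) := by
  rw [Matrix.trace, Finset.sum_range]
  refine Finset.sum_congr rfl fun j _ => ?_
  have hj : 0 < n.choose j := Nat.choose_pos (Nat.le_of_lt_succ j.2)
  have : √(n.choose j : ℝ) ≠ 0 := (Real.sqrt_pos.mpr (by exact_mod_cast hj)).ne'
  simp only [binaryFormMatrix, binaryForm, hg, Matrix.diag_apply, Matrix.of_apply, map_zero,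
    add_zero, mul_pow, ← Polynomial.C_pow, div_self this, Complex.ofReal_one, one_mul]
  rw [mul_assoc, Polynomial.coeff_C_mul, Polynomial.coeff_X_pow_mul', if_pos le_rfl,
    Nat.sub_self, Polynomial.coeff_zero_eq_eval_zero]
  simp

/-- An eigenvector serves as the first column of `P`, up to scaling. `P` need not be unitary,
because `binaryFormMatrix` is multiplicative on all matrices. -/
theorem Matrix.exists_conj_triangular (g : Matrix (Fin 2) (Fin 2) ℂ) :
    ∃ P Q : Matrix (Fin 2) (Fin 2) ℂ, P * Q = 1 ∧ (Q * g * P) 1 0 = 0 := by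
  obtain ⟨μ, hμ⟩ := Module.End.exists_eigenvalue (Matrix.toLin' g)
  obtain ⟨v, hv⟩ := hμ.exists_hasEigenvector
  have hv1 := hv.apply_eq_smul
  rw [Matrix.toLin'_apply] at hv1
  have h0 := congrFun hv1 0
  have h1 := congrFun hv1 1
  simp only [Matrix.mulVec, dotProduct, Fin.sum_univ_two, Pi.smul_apply, smul_eq_mul] at h0 h1
  by_cases hz : v 0 = 0
  · have hw : v 1 ≠ 0 := fun h => hv.2 (by ext i; fin_cases i <;> assumption)
    refine ⟨!![0, 1; 1, 0], !![0, 1; 1, 0], ?_, ?_⟩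
    · ext i j; fin_cases i <;> fin_cases j <;> simp
    · have : g 0 1 = 0 := by simpa [hz, hw] using h0
      rw [Matrix.mul_apply, Fin.sum_univ_two, Matrix.mul_apply, Matrix.mul_apply]
      simp [Fin.sum_univ_two, this]
  · refine ⟨!![v 0, 0; v 1, 1], !![(v 0)⁻¹, 0; -v 1 * (v 0)⁻¹, 1], ?_, ?_⟩
    · ext i j; fin_cases i <;> fin_cases j <;> simp [Matrix.mul_apply, Fin.sum_univ_two, hz]
    · simp only [Matrix.mul_apply, Fin.sum_univ_two, Matrix.of_apply, Matrix.cons_val', Matrix.cons_val_zero,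
        Matrix.cons_val_one, Matrix.cons_val_fin_one]
      field_simp
      linear_combination (-v 1) * h0 + v 0 * h1

/-- The sums are the complete homogeneous polynomials in `a` and `d`; splitting off the top power of
`a` or of `d` relates consecutive ones. -/
theorem sum_pow_mul_recurrence (a d : ℂ) (n : ℕ) :
    (a + d) * ∑ j ∈ Finset.range (n + 2), a ^ j * d ^ (n + 1 - j) =
      ∑ j ∈ Finset.range (n + 3), a ^ j * d ^ (n + 2 - j) +
        a * d * ∑ j ∈ Finset.range (n + 1), a ^ j * d ^ (n - j) := by
  have hr (m : ℕ) : ∑ j ∈ Finset.range (m + 2), a ^ j * d ^ (m + 1 - j) =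
      a ^ (m + 1) + d * ∑ j ∈ Finset.range (m + 1), a ^ j * d ^ (m - j) := by
    simpa using (Commute.all a d).geom_sum₂_succ_eq (n := m + 1)
  have hl (m : ℕ) : ∑ j ∈ Finset.range (m + 2), a ^ j * d ^ (m + 1 - j) =
      d ^ (m + 1) + a * ∑ j ∈ Finset.range (m + 1), a ^ j * d ^ (m - j) := by
    rw [Finset.sum_range_succ', Finset.mul_sum, add_comm]
    congr 1
    · simp
    · refine Finset.sum_congr rfl fun j _ => ?_
      rw [Nat.add_sub_add_right]
      ring
  have h1 := hr (n + 1)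
  have h2 := hl n
  rw [h1]
  linear_combination a * hr n

theorem binaryFormMatrix_trace_conj (n : ℕ) {P Q : Matrix (Fin 2) (Fin 2) ℂ} (h : P * Q = 1)
    (g : Matrix (Fin 2) (Fin 2) ℂ) :
    (binaryFormMatrix n (Q * g * P)).trace = (binaryFormMatrix n g).trace := by
  rw [binaryFormMatrix_mul, Matrix.trace_mul_comm, ← binaryFormMatrix_mul, ← mul_assoc, h,
    one_mul]

/-- Every term is invariant under conjugation, so the triangular case suffices. -/
theorem binaryFormMatrix_trace_recurrence (n : ℕ) (g : Matrix (Fin 2) (Fin 2) ℂ) :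
    g.trace * (binaryFormMatrix (n + 1) g).trace =
      (binaryFormMatrix (n + 2) g).trace + g.det * (binaryFormMatrix n g).trace := by
  obtain ⟨P, Q, hPQ, h⟩ := Matrix.exists_conj_triangular g
  have htr : g.trace = (Q * g * P).trace := by
    rw [Matrix.trace_mul_comm, ← mul_assoc, hPQ, one_mul]
  have hdet : g.det = (Q * g * P).det := by
    have := congrArg Matrix.det hPQ
    rw [Matrix.det_mul, Matrix.det_one] at this
    rw [Matrix.det_mul, Matrix.det_mul]
    linear_combination (-g.det) * this
  rw [htr, hdet, ← binaryFormMatrix_trace_conj _ hPQ g, ← binaryFormMatrix_trace_conj _ hPQ g,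
    ← binaryFormMatrix_trace_conj _ hPQ g]
  simp only [binaryFormMatrix_trace_of_triangular _ _ h, Matrix.trace_fin_two,
    Matrix.det_fin_two, h, mul_zero, sub_zero]
  exact sum_pow_mul_recurrence _ _ n

theorem su2Char_zero (u : SU2) : su2Char 0 u = 1 := by
  simp [su2Char, su2Rep, binaryFormMatrix, binaryForm, Matrix.trace]

theorem su2Char_one (u : SU2) : su2Char 1 u = u.1.trace := by
  simp [su2Char, su2Rep, binaryFormMatrix, binaryForm, Matrix.trace, Fin.sum_univ_two,
    Polynomial.coeff_X, Polynomial.coeff_C]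
  ring

theorem su2Char_recurrence (n : ℕ) (u : SU2) :
    su2Char 1 u * su2Char (n + 1) u = su2Char (n + 2) u + su2Char n u := by
  have := binaryFormMatrix_trace_recurrence n u.1
  rw [(Matrix.mem_specialUnitaryGroup_iff.mp u.2).2, one_mul] at this
  rw [su2Char_one]
  exact this

theorem star_su2Char (n : ℕ) (u : SU2) : star (su2Char n u) = su2Char n u := by
  have h1 : star (su2Char 1 u) = su2Char 1 u := by
    obtain ⟨hu, hd⟩ := Matrix.mem_specialUnitaryGroup_iff.mp u.2
    -- In determinant one the adjugate is the inverse, and in size two it has the same trace as the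
    -- matrix.
    have hs : star u.1 = u.1.adjugate := by
      have h := Matrix.mem_unitaryGroup_iff'.mp hu
      calc star u.1 = star u.1 * (u.1 * u.1.adjugate) := by
            rw [Matrix.mul_adjugate, hd, one_smul, mul_one]
        _ = u.1.adjugate := by rw [← mul_assoc, h, one_mul]
    rw [su2Char_one, ← Matrix.trace_conjTranspose, ← Matrix.star_eq_conjTranspose, hs,
      Matrix.adjugate_fin_two, Matrix.trace_fin_two_of, Matrix.trace_fin_two, add_comm]
  induction n using Nat.strong_induction_on with
  | _ n ih =>
    match n with
    | 0 => simp [su2Char_zero]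
    | 1 => exact h1
    | n + 2 =>
      have : su2Char (n + 2) u = su2Char 1 u * su2Char (n + 1) u - su2Char n u := by
        rw [su2Char_recurrence]; ring
      rw [this, star_sub, star_mul', h1, ih (n + 1) (by omega), ih n (by omega)]

/-! ### Vanishing integrals and orthonormality of characters -/

theorem integral_su2Rep_mul (n : ℕ) (v : SU2) (i j : Fin (n + 1)) :
    ∫ u, (su2Rep n u).1 i j ∂SU2.haar =
      ∑ k, (su2Rep n v).1 i k * ∫ u, (su2Rep n u).1 k j ∂SU2.haar := by
  rw [← integral_mul_left_eq_self _ v]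
  have : ∀ u, (su2Rep n (v * u)).1 i j = ∑ k, (su2Rep n v).1 i k * (su2Rep n u).1 k j := by
    intro u
    rw [map_mul]
    exact Matrix.mul_apply
  simp only [this]
  rw [integral_finsetSum _ fun k _ =>
    (SU2.integrable_of_continuous (continuous_su2Rep_apply n k j)).const_mul _]
  simp only [integral_const_mul]

/-- The diagonal torus of `SU(2)`. -/
noncomputable def SU2.torus (θ : ℝ) : SU2 :=
  ⟨!![Complex.exp (θ * Complex.I), 0; 0, Complex.exp (-(θ * Complex.I))], by
    rw [Matrix.mem_specialUnitaryGroup_iff, Matrix.mem_unitaryGroup_iff]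
    constructor
    · ext i j
      fin_cases i <;> fin_cases j <;>
        simp [Matrix.mul_apply, Fin.sum_univ_two, Matrix.star_apply, ← Complex.exp_conj,
          ← Complex.exp_add]
    · simp [← Complex.exp_add]⟩

theorem su2Rep_torus (n : ℕ) (θ : ℝ) (i j : Fin (n + 1)) :
    (su2Rep n (SU2.torus θ)).1 i j =
      if i = j then Complex.exp ((2 * (i : ℝ) - n) * θ * Complex.I) else 0 := by
  have hj : 0 < n.choose j := Nat.choose_pos (Nat.le_of_lt_succ j.2)
  have : √(n.choose j : ℝ) ≠ 0 := (Real.sqrt_pos.mpr (by exact_mod_cast hj)).ne'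
  simp only [su2Rep, SU2.torus, MonoidHom.coe_mk, OneHom.coe_mk, binaryFormMatrix, binaryForm,
    Matrix.of_apply, Matrix.cons_val', Matrix.cons_val_zero, Matrix.cons_val_one,
    Matrix.cons_val_fin_one, map_zero, add_zero, zero_mul, zero_add, mul_pow, ← Polynomial.C_pow]
  rw [mul_right_comm, ← Polynomial.C_mul, Polynomial.coeff_C_mul, Polynomial.coeff_X_pow]
  by_cases h : i = j
  · subst h
    simp only [if_pos, div_self this, Complex.ofReal_one, one_mul, mul_one]
    rw [← Complex.exp_nat_mul, ← Complex.exp_nat_mul, ← Complex.exp_add,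
      Nat.cast_sub (Nat.le_of_lt_succ i.2)]
    congr 1
    push_cast
    ring
  · have : (i : ℕ) ≠ j := fun h' => h (Fin.ext h')
    simp [h, this]

/-- The rotation of the plane by an eighth of a turn. -/
noncomputable def SU2.eighthTurn : SU2 :=
  ⟨!![((√2)⁻¹ : ℝ), -((√2)⁻¹ : ℝ); ((√2)⁻¹ : ℝ), ((√2)⁻¹ : ℝ)], by
    have h : (((√2)⁻¹ : ℝ) : ℂ) * (((√2)⁻¹ : ℝ) : ℂ) = 1 / 2 := by
      rw [← Complex.ofReal_mul, ← mul_inv, Real.mul_self_sqrt (by norm_num)]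
      norm_num
    rw [Matrix.mem_specialUnitaryGroup_iff, Matrix.mem_unitaryGroup_iff]
    constructor
    · ext i j
      fin_cases i <;> fin_cases j <;>
        simp [Matrix.mul_apply, Fin.sum_univ_two, Matrix.star_apply, -Complex.ofReal_inv, h] <;>
        norm_num
    · rw [Matrix.det_fin_two_of, h, neg_mul, h]
      norm_num⟩

theorem su2Rep_eighthTurn_zero_ne (n : ℕ) (j : Fin (n + 1)) :
    (su2Rep n SU2.eighthTurn).1 0 j ≠ 0 := by
  have hj : 0 < n.choose j := Nat.choose_pos (Nat.le_of_lt_succ j.2)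
  have : √(n.choose j : ℝ) ≠ 0 := (Real.sqrt_pos.mpr (by exact_mod_cast hj)).ne'
  simp [su2Rep, SU2.eighthTurn, binaryFormMatrix, binaryForm, Polynomial.coeff_zero_eq_eval_zero,
    this]

/-- By left invariance each column of integrals is a vector fixed by the representation. The torus
kills its components of nonzero weight; the eighth turn, whose row `0` has no zero entry, kills the
remaining one. -/
theorem integral_su2Rep_eq_zero {n : ℕ} (hn : n ≠ 0) (i j : Fin (n + 1)) :
    ∫ u, (su2Rep n u).1 i j ∂SU2.haar = 0 := by
  have hoff (i : Fin (n + 1)) (hi : 2 * (i : ℕ) ≠ n) :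
      ∫ u, (su2Rep n u).1 i j ∂SU2.haar = 0 := by
    have hne : (2 * (i : ℝ) - n) ≠ 0 := sub_ne_zero.mpr (by exact_mod_cast hi)
    -- The angle is chosen so that the torus element acts on row `i` by `exp (π I) = -1`.
    have h := integral_su2Rep_mul n (SU2.torus (Real.pi / (2 * (i : ℝ) - n))) i j
    simp only [su2Rep_torus, ite_mul, zero_mul, Finset.sum_ite_eq, Finset.mem_univ, if_true] at h
    have he : (2 * ((i : ℝ) : ℂ) - n) * ((Real.pi / (2 * (i : ℝ) - n) : ℝ) : ℂ) = Real.pi := by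
      push_cast
      rw [← mul_div_assoc]
      exact_mod_cast congrArg (fun r : ℝ => (r : ℂ)) (mul_div_cancel_left₀ Real.pi hne)
    rw [he, Complex.exp_pi_mul_I] at h
    linear_combination h / 2
  by_cases hi : 2 * (i : ℕ) = n
  · have h := integral_su2Rep_mul n SU2.eighthTurn 0 j
    rw [hoff 0 (by simpa using hn.symm), Finset.sum_eq_single i] at h
    · exact (mul_eq_zero.mp h.symm).resolve_left (su2Rep_eighthTurn_zero_ne n i)
    · intro k _ hk
      rw [hoff k fun h => hk (Fin.ext (by omega)), mul_zero]
    · simp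
  · exact hoff i hi

theorem integral_su2Char (n : ℕ) : ∫ u, su2Char n u ∂SU2.haar = if n = 0 then 1 else 0 := by
  split_ifs with h
  · subst h
    simp [su2Char_zero]
  · have : ∀ u, su2Char n u = ∑ i, (su2Rep n u).1 i i := fun u => rfl
    simp only [this]
    rw [integral_finsetSum _ fun i _ =>
      SU2.integrable_of_continuous (continuous_su2Rep_apply n i i)]
    exact Finset.sum_eq_zero fun i _ => integral_su2Rep_eq_zero h i i

/-- Induction on `m`: the recurrence moves a factor `χ_1` from one character to the other. -/
theorem integral_su2Char_mul (n m : ℕ) :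
    ∫ u, su2Char n u * su2Char m u ∂SU2.haar = if n = m then 1 else 0 := by
  have hint (a b : ℕ) : Integrable (fun u => su2Char a u * su2Char b u) SU2.haar :=
    SU2.integrable_of_continuous ((continuous_su2Char a).mul (continuous_su2Char b))
  have hrec (a m : ℕ) : ∫ u, su2Char (a + 2) u * su2Char m u ∂SU2.haar +
      ∫ u, su2Char a u * su2Char m u ∂SU2.haar =
      ∫ u, su2Char (a + 1) u * (su2Char 1 u * su2Char m u) ∂SU2.haar := by
    rw [← integral_add (hint _ _) (hint _ _)]
    refine integral_congr_ae (Filter.Eventually.of_forall fun u => ?_)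
    simp only
    linear_combination -su2Char m u * su2Char_recurrence a u
  have hmul (a m : ℕ) : ∫ u, su2Char a u * (su2Char 1 u * su2Char (m + 1) u) ∂SU2.haar =
      ∫ u, su2Char a u * su2Char (m + 2) u ∂SU2.haar +
        ∫ u, su2Char a u * su2Char m u ∂SU2.haar := by
    simp only [su2Char_recurrence, mul_add]
    exact integral_add (hint _ _) (hint _ _)
  induction m using Nat.strong_induction_on generalizing n with
  | _ m ih =>
    match m, n with
    | 0, n => simpa [su2Char_zero] using integral_su2Char n
    | m + 1, 0 => simpa [su2Char_zero] using integral_su2Char (m + 1)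
    | 1, n + 1 =>
      have h := hrec n 0
      simp only [su2Char_zero, mul_one] at h
      rw [← h, integral_su2Char, integral_su2Char]
      simp
    | m + 2, n + 1 =>
      have h := hmul (n + 1) m
      rw [← hrec n (m + 1), ih (m + 1) (by omega), ih (m + 1) (by omega), ih m (by omega)] at h
      refine (eq_sub_of_add_eq h.symm).trans ?_
      -- The conditions `n + 2 = m + 1` and `n + 1 = m` cancel, leaving `n = m + 1`.
      split_ifs <;> first | omega | norm_num

/-! ### The Dirichlet kernel and its norms -/

theorem trace_su2Fourier {f : SU2 → ℂ} (hf : Integrable f SU2.haar) (n : ℕ) :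
    (su2Fourier f n).trace = ∫ u, f u * su2Char n u ∂SU2.haar := by
  have hint (i : Fin (n + 1)) :
      Integrable (fun u => f u * (star (su2Rep n u).1) i i) SU2.haar := by
    refine hf.mul_bdd (c := 1)
      (continuous_star.comp (continuous_su2Rep_apply n i i)).aestronglyMeasurable
      (Filter.Eventually.of_forall fun u => ?_)
    exact (norm_star _).trans_le (entry_norm_bound_of_unitary (su2Rep n u).2 i i)
  rw [Matrix.trace]
  simp only [su2Fourier, Matrix.diag_apply, Matrix.of_apply]
  rw [← integral_finsetSum _ fun i _ => hint i]
  refine integral_congr_ae (Filter.Eventually.of_forall fun u => ?_)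
  simp only
  rw [← Finset.mul_sum, ← star_su2Char n u, su2Char, ← Matrix.trace_conjTranspose]
  rfl

/-- The Dirichlet kernel of `SU(2)`. -/
noncomputable def su2Dirichlet (k : ℕ) (u : SU2) : ℂ :=
  ∑ l ∈ Finset.range (k + 1), ((l : ℂ) + 1) * su2Char l u

theorem continuous_su2Dirichlet (k : ℕ) : Continuous (su2Dirichlet k) :=
  continuous_finsetSum _ fun l _ => continuous_const.mul (continuous_su2Char l)

/-- The same sum bounds both the supremum and the squared `L²` norm of the Dirichlet kernel. -/
theorem sum_add_one_sq_le (k : ℕ) :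
    ∑ l ∈ Finset.range (k + 1), ((l : ℝ) + 1) ^ 2 ≤ ((k : ℝ) + 1) ^ 3 := by
  calc ∑ l ∈ Finset.range (k + 1), ((l : ℝ) + 1) ^ 2
      ≤ ∑ l ∈ Finset.range (k + 1), ((k : ℝ) + 1) ^ 2 := by
        refine Finset.sum_le_sum fun l hl => ?_
        have : (l : ℝ) ≤ k := by exact_mod_cast Nat.le_of_lt_succ (Finset.mem_range.mp hl)
        gcongr
    _ = ((k : ℝ) + 1) ^ 3 := by
        simp
        ring

theorem norm_su2Dirichlet_le (k : ℕ) (u : SU2) : ‖su2Dirichlet k u‖ ≤ ((k : ℝ) + 1) ^ 3 := by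
  refine (norm_sum_le _ _).trans (le_trans (Finset.sum_le_sum fun l _ => ?_) (sum_add_one_sq_le k))
  have h : ‖(l : ℂ) + 1‖ = (l : ℝ) + 1 := by exact_mod_cast Complex.norm_natCast (l + 1)
  rw [norm_mul, h, sq]
  gcongr
  exact norm_su2Char_le l u

theorem integral_norm_sq_su2Dirichlet_le (k : ℕ) :
    ∫ u, ‖su2Dirichlet k u‖ ^ 2 ∂SU2.haar ≤ ((k : ℝ) + 1) ^ 3 := by
  have hsq (u : SU2) : ((‖su2Dirichlet k u‖ ^ 2 : ℝ) : ℂ) =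
      ∑ l ∈ Finset.range (k + 1), ∑ m ∈ Finset.range (k + 1),
        ((l : ℂ) + 1) * ((m : ℂ) + 1) * (su2Char l u * su2Char m u) := by
    have hstar : star (su2Dirichlet k u) = su2Dirichlet k u := by
      simp only [su2Dirichlet, star_sum, star_mul', star_su2Char]
      simp
    have := Complex.mul_conj' (su2Dirichlet k u)
    rw [← RCLike.star_def, hstar] at this
    rw [Complex.ofReal_pow, ← this, su2Dirichlet, Finset.sum_mul_sum]
    refine Finset.sum_congr rfl fun l _ => Finset.sum_congr rfl fun m _ => ?_
    ring
  have hint (l m : ℕ) : Integrable (fun u => ((l : ℂ) + 1) * ((m : ℂ) + 1) *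
      (su2Char l u * su2Char m u)) SU2.haar :=
    SU2.integrable_of_continuous
      (continuous_const.mul ((continuous_su2Char l).mul (continuous_su2Char m)))
  have heq : ∫ u, ‖su2Dirichlet k u‖ ^ 2 ∂SU2.haar =
      ∑ l ∈ Finset.range (k + 1), ((l : ℝ) + 1) ^ 2 := by
    apply Complex.ofReal_injective
    rw [← integral_complex_ofReal]
    simp only [hsq]
    rw [integral_finsetSum _ fun l _ => integrable_finsetSum _ fun m _ => hint l m,
      Complex.ofReal_sum]
    refine Finset.sum_congr rfl fun l hl => ?_
    rw [integral_finsetSum _ fun m _ => hint l m]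
    simp only [integral_const_mul, integral_su2Char_mul, mul_ite, mul_one, mul_zero,
      Finset.sum_ite_eq, if_pos hl]
    push_cast
    ring
  exact heq.trans_le (sum_add_one_sq_le k)

/-- Write `|D| ^ q = |D| ^ (q - 2) |D| ^ 2`, then use the sup bound on the first factor and the `L²`
bound on the second. -/
theorem lintegral_su2Dirichlet_rpow_le (k : ℕ) {q : ℝ} (hq : 2 ≤ q) :
    ∫⁻ u, ‖su2Dirichlet k u‖ₑ ^ q ∂SU2.haar ≤
      ENNReal.ofReal (((k : ℝ) + 1) ^ (3 * (q - 1))) := by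
  have hk : (0 : ℝ) < (k : ℝ) + 1 := by positivity
  have hint : Integrable (fun u => ‖su2Dirichlet k u‖ ^ 2) SU2.haar :=
    ((continuous_su2Dirichlet k).norm.pow 2).integrable_of_hasCompactSupport
      (HasCompactSupport.of_compactSpace _)
  calc ∫⁻ u, ‖su2Dirichlet k u‖ₑ ^ q ∂SU2.haar
      ≤ ∫⁻ u, ENNReal.ofReal ((((k : ℝ) + 1) ^ 3) ^ (q - 2) * ‖su2Dirichlet k u‖ ^ 2)
          ∂SU2.haar := by
        refine lintegral_mono fun u => ?_
        rw [← ofReal_norm,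
          ENNReal.ofReal_rpow_of_nonneg (norm_nonneg _) (by linarith)]
        refine ENNReal.ofReal_le_ofReal ?_
        have : ‖su2Dirichlet k u‖ ^ q =
            ‖su2Dirichlet k u‖ ^ (q - 2) * ‖su2Dirichlet k u‖ ^ 2 := by
          rw [← Real.rpow_natCast, ← Real.rpow_add_of_nonneg (norm_nonneg _) (by linarith)
            (by norm_num)]
          norm_num
        rw [this]
        exact mul_le_mul_of_nonneg_right (Real.rpow_le_rpow (norm_nonneg _)
          (norm_su2Dirichlet_le k u) (by linarith)) (by positivity)
    _ = ENNReal.ofReal ((((k : ℝ) + 1) ^ 3) ^ (q - 2) *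
          ∫ u, ‖su2Dirichlet k u‖ ^ 2 ∂SU2.haar) := by
        rw [← integral_const_mul, ofReal_integral_eq_lintegral_ofReal (hint.const_mul _)
          (Filter.Eventually.of_forall fun u => by positivity)]
    _ ≤ ENNReal.ofReal ((((k : ℝ) + 1) ^ 3) ^ (q - 2) * ((k : ℝ) + 1) ^ 3) := by
        gcongr
        exact integral_norm_sq_su2Dirichlet_le k
    _ = ENNReal.ofReal (((k : ℝ) + 1) ^ (3 * (q - 1))) := by
        congr 1
        rw [← Real.rpow_natCast, ← Real.rpow_mul hk.le, ← Real.rpow_add hk]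
        congr 1
        push_cast
        ring

theorem sum_trace_su2Fourier {f : SU2 → ℂ} (hf : Integrable f SU2.haar) (k : ℕ) :
    ∑ l ∈ Finset.range (k + 1), ((l : ℂ) + 1) * (su2Fourier f l).trace =
      ∫ u, f u * su2Dirichlet k u ∂SU2.haar := by
  have hint (l : ℕ) : Integrable (fun u => ((l : ℂ) + 1) * (f u * su2Char l u)) SU2.haar :=
    (hf.mul_bdd (c := l + 1) (continuous_su2Char l).aestronglyMeasurable
      (Filter.Eventually.of_forall (norm_su2Char_le l))).const_mul _
  simp only [trace_su2Fourier hf, ← integral_const_mul]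
  rw [← integral_finsetSum _ fun l _ => hint l]
  refine integral_congr_ae (Filter.Eventually.of_forall fun u => ?_)
  simp only [su2Dirichlet, Finset.mul_sum]
  exact Finset.sum_congr rfl fun l _ => by ring

/-! ### Hölder's inequality and summation -/

theorem enorm_sum_trace_su2Fourier_le {p : ℝ} (hp1 : 1 < p) (hp2 : p ≤ 2) {f : SU2 → ℂ}
    (hf : MemLp f (ENNReal.ofReal p) SU2.haar) (k : ℕ) :
    ‖∑ l ∈ Finset.range (k + 1), ((l : ℂ) + 1) * (su2Fourier f l).trace‖ₑ ≤
      ENNReal.ofReal (((k : ℝ) + 1) ^ (3 / p)) * eLpNorm f (ENNReal.ofReal p) SU2.haar := by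
  have hp0 : 0 < p := by linarith
  have hk : (0 : ℝ) < (k : ℝ) + 1 := by positivity
  have hpq := Real.HolderConjugate.conjExponent hp1
  set q := Real.conjExponent p with hq
  have hq0 : 0 < q := hpq.symm.pos
  have hq2 : 2 ≤ q := by
    rw [hq, Real.conjExponent, le_div_iff₀ (by linarith)]
    linarith
  have hfi : Integrable f SU2.haar :=
    hf.integrable (by simpa using ENNReal.ofReal_le_ofReal hp1.le)
  rw [sum_trace_su2Fourier hfi]
  calc ‖∫ u, f u * su2Dirichlet k u ∂SU2.haar‖ₑ
      ≤ ∫⁻ u, ‖f u * su2Dirichlet k u‖ₑ ∂SU2.haar := enorm_integral_le_lintegral_enorm _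
    _ = ∫⁻ u, ((fun u => ‖f u‖ₑ) * fun u => ‖su2Dirichlet k u‖ₑ) u ∂SU2.haar := by
        simp [enorm_mul]
    _ ≤ (∫⁻ u, ‖f u‖ₑ ^ p ∂SU2.haar) ^ (1 / p) *
          (∫⁻ u, ‖su2Dirichlet k u‖ₑ ^ q ∂SU2.haar) ^ (1 / q) :=
        ENNReal.lintegral_mul_le_Lp_mul_Lq _ hpq hf.1.enorm
          (continuous_su2Dirichlet k).aestronglyMeasurable.enorm
    _ ≤ eLpNorm f (ENNReal.ofReal p) SU2.haar *
          ENNReal.ofReal (((k : ℝ) + 1) ^ (3 * (q - 1))) ^ (1 / q) := by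
        rw [eLpNorm_eq_lintegral_rpow_enorm_toReal (by simpa using hp0) ENNReal.ofReal_ne_top,
          ENNReal.toReal_ofReal hp0.le]
        gcongr
        exact lintegral_su2Dirichlet_rpow_le k hq2
    _ = ENNReal.ofReal (((k : ℝ) + 1) ^ (3 / p)) * eLpNorm f (ENNReal.ofReal p) SU2.haar := by
        rw [mul_comm, ENNReal.ofReal_rpow_of_nonneg (by positivity) (by positivity),
          ← Real.rpow_mul hk.le]
        congr 3
        -- The exponents match because `3 (q - 1) / q = 3 (1 - 1 / q) = 3 / p`.
        have := hpq.inv_add_inv_eq_one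
        have h1 : p⁻¹ = 1 - q⁻¹ := by linarith
        rw [div_eq_mul_inv 3 p, h1]
        field_simp

theorem iSup_enorm_sum_trace_su2Fourier_le {p : ℝ} (hp1 : 1 < p) (hp2 : p ≤ 2) {f : SU2 → ℂ}
    (hf : MemLp f (ENNReal.ofReal p) SU2.haar) (x : ℕ) :
    (⨆ (k : ℕ) (_ : x + 1 ≤ k + 1),
      ENNReal.ofReal (1 / ((k : ℝ) + 1) ^ 3 *
        ‖∑ l ∈ Finset.range (k + 1), ((l : ℂ) + 1) * (su2Fourier f l).trace‖)) ≤
      ENNReal.ofReal (((x : ℝ) + 1) ^ (3 / p - 3)) * eLpNorm f (ENNReal.ofReal p) SU2.haar := by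
  refine iSup₂_le fun k hk => ?_
  have hk0 : (0 : ℝ) < (k : ℝ) + 1 := by positivity
  rw [ENNReal.ofReal_mul (by positivity), ofReal_norm]
  refine (mul_le_mul_right (enorm_sum_trace_su2Fourier_le hp1 hp2 hf k) _).trans ?_
  rw [← mul_assoc, ← ENNReal.ofReal_mul (by positivity)]
  refine mul_le_mul_left (ENNReal.ofReal_le_ofReal ?_) _
  have h : 1 / ((k : ℝ) + 1) ^ 3 * ((k : ℝ) + 1) ^ (3 / p) = ((k : ℝ) + 1) ^ (3 / p - 3) := by
    rw [Real.rpow_sub hk0, one_div_mul_eq_div]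
    norm_cast
  rw [h]
  -- Since `3 / p - 3 ≤ 0`, the bound decreases in `k` and is largest at `k = x`.
  refine Real.rpow_le_rpow_of_nonpos (by positivity) (by exact_mod_cast hk) ?_
  have : 3 / p ≤ 3 := div_le_self (by norm_num) hp1.le
  linarith

theorem mainTheorem5 (p : ℝ) (hp1 : 1 < p) (hp2 : p ≤ 2) :
    ∃ C : NNReal, ∀ f : SU2 → ℂ, MeasureTheory.MemLp f (ENNReal.ofReal p) SU2.haar →
      ∑' x : ℕ, ENNReal.ofReal (((x : ℝ) + 1) ^ (5 * p / 2 - 4)) *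
          (⨆ (k : ℕ) (_ : x + 1 ≤ k + 1),
            ENNReal.ofReal (1 / ((k : ℝ) + 1) ^ 3 *
              ‖∑ l ∈ Finset.range (k + 1), ((l : ℂ) + 1) * (su2Fourier f l).trace‖)) ^ p ≤
        (C : ENNReal) * (MeasureTheory.eLpNorm f (ENNReal.ofReal p) SU2.haar) ^ p := by
  have hp0 : 0 < p := by linarith
  -- The exponent is the weight plus the `p`-th power of the bound: `(5 p / 2 - 4) + p (3 / p - 3) =
  -- -p / 2 - 1`.
  have hsum : Summable fun x : ℕ => ((x : ℝ) + 1) ^ (-p / 2 - 1) := by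
    have := (summable_nat_add_iff 1).mpr
      (Real.summable_nat_rpow.mpr (show -p / 2 - 1 < -1 by linarith))
    simpa using this
  refine ⟨(∑' x : ℕ, ((x : ℝ) + 1) ^ (-p / 2 - 1)).toNNReal, fun f hf => ?_⟩
  calc _ ≤ ∑' x : ℕ, ENNReal.ofReal (((x : ℝ) + 1) ^ (-p / 2 - 1)) *
        eLpNorm f (ENNReal.ofReal p) SU2.haar ^ p := by
        refine ENNReal.tsum_le_tsum fun x => ?_
        have hx : (0 : ℝ) < (x : ℝ) + 1 := by positivity
        refine (mul_le_mul_right (ENNReal.rpow_le_rpow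
          (iSup_enorm_sum_trace_su2Fourier_le hp1 hp2 hf x) hp0.le) _).trans_eq ?_
        rw [ENNReal.mul_rpow_of_nonneg _ _ hp0.le,
          ENNReal.ofReal_rpow_of_nonneg (by positivity) hp0.le, ← mul_assoc,
          ← ENNReal.ofReal_mul (by positivity), ← Real.rpow_mul hx.le, ← Real.rpow_add hx]
        congr 3
        field_simp
        ring
    _ = _ := by
        rw [ENNReal.tsum_mul_right, ← ENNReal.ofReal_tsum_of_nonneg (fun x => by positivity) hsum]
        rfl
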